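/- Let $n,m\ge 0$, $d\ge 2$, $0\le t\le N-1$ be integers, and let $w_0,\dots,w_{N-1}$ be real square-integrable random variables on a probability space, $\mathcal F_k=\sigma(w_0,\dots,w_{k-1})$ ($\mathcal F_0$ trivial), $\mathbb E_k=\mathbb E[\,\cdot\,|\mathcal F_k]$, with $\mathbb E_k[w_k]=0$ and $\mathbb E_k[w_k^2]=1$ for $0\le k\le N-1$. Let $A_k,C_k,Q_k\in\mathbb R^{n\times n}$, $B_k,D_k\in\mathbb R^{n\times m}$, $R_k\in\mathbb R^{m\times m}$ and $G\in\mathbb R^{n\times n}$ be deterministic matrices. For $k\in\{t,\dots,N-1\}$ and $\xi\in\mathbb R^n$ let $\mathcal U^k_{ad}$ be the set of all $u=(u_k,\dots,u_{N-1})$ such that every $u_\ell$ is an $\mathbb R^m$-valued random variable with $\mathbb E|u_\ell|^2<\infty$ that is $\mathcal F_t$-measurable if $\ell<t+d$ and $\mathcal F_{\ell-d}$-measurable if $\ell\ge t+d$. For $u\in\mathcal U^k_{ad}$ let $X_k=\xi$, $$X_{\ell+1}=(A_\ell X_\ell+B_\ell u_\ell)+(C_\ell X_\ell+D_\ell u_\ell)w_\ell,\qquad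 \ell=k,\dots,N-1,$$ $$J(k,\xi;u)=\sum_{\ell=k}^{N-1}\mathbb E\big[X_\ell^TQ_\ell X_\ell+u_\ell^TR_\ell u_\ell\big]+\mathbb E\big[X_N^TGX_N\big].$$ Suppose that $Q_k,R_k$ ($k=t,\dots,N-1$) and $G$ are symmetric positive semidefinite. Then the following hold. (1) The delayed linear-quadratic problem is solvable: for all $k\in\{t,\dots,N-1\}$ and $\xi\in\mathbb R^n$ there is $\bar u\in\mathcal U^k_{ad}$ with $J(k,\xi;\bar u)=\inf_{u\in\mathcal U^k_{ad}}J(k,\xi;u)$. (2) The constrained Riccati-like equations are solvable: there are matrices $P^{(i)}_k\in\mathbb R^{n\times n}$ ($0\le i\le d$, $t\le k\le N$) with $P^{(0)}_N=G$, $P^{(j)}_N=0$ ($1\le j\le d$), such that, with $M^\dagger$ the Moore–Penrose inverse of $M$, $r_k=d$ for $k\ge t+d$, $r_k=k+1-t$ for $t\le k\le t+d-1$, and $$W_k=R_k+\sum_{i=0}^{r_k}B_k^TP^{(i)}_{k+1}B_k+D_k^TP^{(0)}_{k+1}D_k,\qquad H_k=\sum_{i=0}^{r_k}B_k^TP^{(i)}_{k+1}A_k+D_k^TP^{(0)}_{k+1}C_k,$$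 one has, for every $k\in\{t,\dots,N-1\}$, that $W_k$ is symmetric positive semidefinite, $W_kW_k^\dagger H_k=H_k$, and: - if $k\ge t+1$, $P^{(0)}_k=Q_k+A_k^T(P^{(0)}_{k+1}+P^{(1)}_{k+1})A_k+C_k^TP^{(0)}_{k+1}C_k$; - if $k\ge t+d$, $P^{(i)}_k=A_k^TP^{(i+1)}_{k+1}A_k$ for $1\le i\le d-1$, and $P^{(d)}_k=-H_k^TW_k^\dagger H_k$; - if $t+1\le k\le t+d-1$, $P^{(i)}_k=A_k^TP^{(i+1)}_{k+1}A_k$ for $1\le i\le k-t-1$, and $P^{(k-t)}_k=A_k^TP^{(k+1-t)}_{k+1}A_k-H_k^TW_k^\dagger H_k$; - if $k=t$, $P^{(0)}_t=Q_t+A_t^T(P^{(0)}_{t+1}+P^{(1)}_{t+1})A_t+C_t^TP^{(0)}_{t+1}C_t-H_t^TW_t^\dagger H_t$. -/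

import Mathlib

open MeasureTheory Matrix

namespace DelayedLQ

/-! ### The Moore–Penrose inverse of a real matrix -/

/-- The four Penrose conditions: `X` is the Moore–Penrose inverse of `M`. -/
structure IsMoorePenrose {m n : ℕ} (M : Matrix (Fin m) (Fin n) ℝ) (X : Matrix (Fin n) (Fin m) ℝ) :
    Prop where
  mul_mul : M * X * M = M
  mul_mul' : X * M * X = X
  symm_left : (M * X)ᵀ = M * X
  symm_right : (X * M)ᵀ = X * M

theorem IsMoorePenrose.unique {m n : ℕ} {M : Matrix (Fin m) (Fin n) ℝ}
    {X Y : Matrix (Fin n) (Fin m) ℝ} (hX : IsMoorePenrose M X) (hY : IsMoorePenrose M Y) :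
    X = Y := by
  have h1 : M * X = M * Y := by
    calc M * X = (M * X)ᵀ := hX.symm_left.symm
      _ = ((M * Y) * (M * X))ᵀ := by rw [← Matrix.mul_assoc, hY.mul_mul]
      _ = (M * X)ᵀ * (M * Y)ᵀ := Matrix.transpose_mul _ _
      _ = (M * X) * (M * Y) := by rw [hX.symm_left, hY.symm_left]
      _ = M * Y := by rw [← Matrix.mul_assoc, hX.mul_mul]
  have h2 : X * M = Y * M := by
    calc X * M = (X * M)ᵀ := hX.symm_right.symm
      _ = ((X * M) * (Y * M))ᵀ := by
          rw [Matrix.mul_assoc X M (Y * M), ← Matrix.mul_assoc M Y M, hY.mul_mul]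
      _ = (Y * M)ᵀ * (X * M)ᵀ := Matrix.transpose_mul _ _
      _ = (Y * M) * (X * M) := by rw [hX.symm_right, hY.symm_right]
      _ = Y * M := by rw [Matrix.mul_assoc Y M (X * M), ← Matrix.mul_assoc M X M, hX.mul_mul]
  calc X = X * M * X := hX.mul_mul'.symm
    _ = Y * (M * X) := by rw [h2, Matrix.mul_assoc]
    _ = Y * M * Y := by rw [h1, Matrix.mul_assoc]
    _ = Y := hY.mul_mul'

theorem exists_isMoorePenrose_of_isHermitian {n : ℕ} {S : Matrix (Fin n) (Fin n) ℝ}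
    (hS : S.IsHermitian) : ∃ X, IsMoorePenrose S X ∧ Xᵀ = X := by
  set U : Matrix (Fin n) (Fin n) ℝ := (hS.eigenvectorUnitary : Matrix (Fin n) (Fin n) ℝ) with hU
  set e := hS.eigenvalues with he
  have hUU : Uᵀ * U = 1 := by
    have := Unitary.coe_star_mul_self hS.eigenvectorUnitary
    rwa [Matrix.star_eq_conjTranspose, Matrix.conjTranspose_eq_transpose_of_trivial] at this
  have hsp : S = U * diagonal e * Uᵀ := by
    have := hS.spectral_theorem
    rw [Unitary.conjStarAlgAut_apply] at this
    rw [Matrix.star_eq_conjTranspose, Matrix.conjTranspose_eq_transpose_of_trivial] at this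
    exact this
  have key : ∀ a b : Fin n → ℝ,
      (U * diagonal a * Uᵀ) * (U * diagonal b * Uᵀ) = U * diagonal (fun i => a i * b i) * Uᵀ := by
    intro a b
    calc (U * diagonal a * Uᵀ) * (U * diagonal b * Uᵀ)
        = U * diagonal a * (Uᵀ * U) * diagonal b * Uᵀ := by simp only [Matrix.mul_assoc]
      _ = U * (diagonal a * diagonal b) * Uᵀ := by rw [hUU]; simp only [Matrix.mul_assoc,
            Matrix.mul_one]
      _ = _ := by rw [Matrix.diagonal_mul_diagonal]
  have keyT : ∀ a : Fin n → ℝ, (U * diagonal a * Uᵀ)ᵀ = U * diagonal a * Uᵀ := by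
    intro a
    simp [Matrix.transpose_mul, Matrix.mul_assoc]
  refine ⟨U * diagonal (fun i => (e i)⁻¹) * Uᵀ, ⟨?_, ?_, ?_, ?_⟩, keyT _⟩
  · rw [hsp, key, key]; congr; funext i; exact mul_inv_mul_cancel (e i)
  · rw [hsp, key, key]; congr; funext i; simpa using mul_inv_mul_cancel (e i)⁻¹
  · rw [hsp, key, keyT]
  · rw [hsp, key, keyT]

theorem exists_isMoorePenrose {m n : ℕ} (M : Matrix (Fin m) (Fin n) ℝ) :
    ∃ X, IsMoorePenrose M X := by
  have hS : (Mᵀ * M).IsHermitian := by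
    simp [Matrix.IsHermitian, Matrix.conjTranspose_eq_transpose_of_trivial, Matrix.transpose_mul]
  obtain ⟨Y, hY, hYT⟩ := exists_isMoorePenrose_of_isHermitian hS
  have hM : M * (Y * (Mᵀ * M)) = M := by
    have h0 : (M * (Y * (Mᵀ * M)) - M)ᵀ * (M * (Y * (Mᵀ * M)) - M) = 0 := by
      have h1 : Mᵀ * (M * (Y * (Mᵀ * M)) - M) = 0 := by
        rw [Matrix.mul_sub, sub_eq_zero]
        simpa only [Matrix.mul_assoc] using hY.mul_mul
      have h2 : (M * (Y * (Mᵀ * M)) - M) = M * (Y * (Mᵀ * M) - 1) := by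
        rw [Matrix.mul_sub, Matrix.mul_one]
      nth_rewrite 1 [h2]
      rw [Matrix.transpose_mul, Matrix.mul_assoc, h1, Matrix.mul_zero]
    rw [← Matrix.conjTranspose_eq_transpose_of_trivial,
      Matrix.conjTranspose_mul_self_eq_zero] at h0
    exact sub_eq_zero.mp h0
  refine ⟨Y * Mᵀ, ⟨?_, ?_, ?_, ?_⟩⟩
  · simpa only [Matrix.mul_assoc] using hM
  · calc Y * Mᵀ * M * (Y * Mᵀ) = (Y * (Mᵀ * M) * Y) * Mᵀ := by simp only [Matrix.mul_assoc]
      _ = Y * Mᵀ := by rw [hY.mul_mul']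
  · simp only [Matrix.transpose_mul, Matrix.transpose_transpose, hYT, Matrix.mul_assoc]
  · rw [Matrix.mul_assoc]; exact hY.symm_right

/-- The Moore–Penrose inverse `M†` of a real matrix `M`. -/
noncomputable def pinv {m n : ℕ} (M : Matrix (Fin m) (Fin n) ℝ) : Matrix (Fin n) (Fin m) ℝ :=
  Classical.choose (exists_isMoorePenrose M)

theorem isMoorePenrose_pinv {m n : ℕ} (M : Matrix (Fin m) (Fin n) ℝ) :
    IsMoorePenrose M (pinv M) :=
  Classical.choose_spec (exists_isMoorePenrose M)

/-! ### The delayed linear-quadratic problem -/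

/-- The deterministic coefficients of the controlled system and of the cost functional
(no definiteness is imposed here). Only the values at times `0, …, N - 1` are ever used. -/
structure Coeffs (n m : ℕ) where
  A : ℕ → Matrix (Fin n) (Fin n) ℝ
  B : ℕ → Matrix (Fin n) (Fin m) ℝ
  C : ℕ → Matrix (Fin n) (Fin n) ℝ
  D : ℕ → Matrix (Fin n) (Fin m) ℝ
  Q : ℕ → Matrix (Fin n) (Fin n) ℝ
  R : ℕ → Matrix (Fin m) (Fin m) ℝ
  G : Matrix (Fin n) (Fin n) ℝ

section Control

variable {Ω : Type*}

/-- `ℱ_k = σ(w_l : 0 ≤ l ≤ k - 1)`; in particular `ℱ_0` is trivial. -/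
@[reducible] def info (w : ℕ → Ω → ℝ) (k : ℕ) : MeasurableSpace Ω :=
  ⨆ l, ⨆ _ : l < k, MeasurableSpace.comap (w l) inferInstance

/-- `w_0, …, w_{N-1}` is a martingale difference sequence with unit conditional second moments:
`𝔼[w_k | ℱ_k] = 0` and `𝔼[w_k² | ℱ_k] = 1` almost surely. -/
structure IsNoise [MeasurableSpace Ω] (μ : Measure Ω) (N : ℕ) (w : ℕ → Ω → ℝ) : Prop where
  measurable : ∀ k < N, Measurable (w k)
  memLp : ∀ k < N, MemLp (w k) 2 μ
  condExp_eq_zero : ∀ k < N, μ[w k | info w k] =ᵐ[μ] fun _ => 0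
  condExp_sq_eq_one : ∀ k < N, μ[fun ω => w k ω ^ 2 | info w k] =ᵐ[μ] fun _ => 1

/-- The information available to the controller at time `l`, for the problem whose reference
initial time is `t` and whose transmission delay is `d`: `ℱ_t` before time `t + d`, and
`ℱ_{l-d}` from then on. -/
@[reducible] def delayedInfo (w : ℕ → Ω → ℝ) (d t l : ℕ) : MeasurableSpace Ω :=
  if l < t + d then info w t else info w (l - d)

/-- The admissible controls `u = (u_k, …, u_{N-1})`: each `u_l` is square integrable and
measurable with respect to the delayed information. (Values of `u` outside `k, …, N - 1` are
irrelevant.) -/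
def admissible [MeasurableSpace Ω] (μ : Measure Ω) {m : ℕ} (w : ℕ → Ω → ℝ) (N d t k : ℕ) :
    Set (ℕ → Ω → Fin m → ℝ) :=
  {u | ∀ l, k ≤ l → l < N →
    Measurable[delayedInfo w d t l] (u l) ∧ Integrable (fun ω => u l ω ⬝ᵥ u l ω) μ}

/-- The state `X_l`, `l ≥ k`, started from `X_k = ξ` and driven by the control `u` and the
noise `w`: `X_{l+1} = (A_l X_l + B_l u_l) + (C_l X_l + D_l u_l) w_l`.
(By convention it equals `ξ` before time `k`.) -/
def state {n m : ℕ} (c : Coeffs n m) (w : ℕ → Ω → ℝ) (k : ℕ) (ξ : Fin n → ℝ)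
    (u : ℕ → Ω → Fin m → ℝ) : ℕ → Ω → Fin n → ℝ
  | 0 => fun _ => ξ
  | l + 1 => fun ω =>
      if k ≤ l then
        (c.A l *ᵥ state c w k ξ u l ω + c.B l *ᵥ u l ω)
          + w l ω • (c.C l *ᵥ state c w k ξ u l ω + c.D l *ᵥ u l ω)
      else ξ

/-- The cost `J(k, ξ; u) = ∑_{l=k}^{N-1} 𝔼[X_lᵀ Q_l X_l + u_lᵀ R_l u_l] + 𝔼[X_Nᵀ G X_N]`.
For an admissible `u` the state is square integrable, so all these expectations are finite. -/
noncomputable def cost [MeasurableSpace Ω] (μ : Measure Ω) {n m : ℕ} (c : Coeffs n m)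
    (w : ℕ → Ω → ℝ) (N k : ℕ) (ξ : Fin n → ℝ) (u : ℕ → Ω → Fin m → ℝ) : ℝ :=
  ∑ l ∈ Finset.Ico k N,
      ∫ ω, (state c w k ξ u l ω ⬝ᵥ c.Q l *ᵥ state c w k ξ u l ω + u l ω ⬝ᵥ c.R l *ᵥ u l ω) ∂μ
    + ∫ ω, state c w k ξ u N ω ⬝ᵥ c.G *ᵥ state c w k ξ u N ω ∂μ

/-- The delayed problem is solvable at `(k, ξ)`: some admissible control attains the infimum of
the cost over all admissible controls. -/
def SolvableAt [MeasurableSpace Ω] (μ : Measure Ω) {n m : ℕ} (c : Coeffs n m)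
    (w : ℕ → Ω → ℝ) (N d t k : ℕ) (ξ : Fin n → ℝ) : Prop :=
  ∃ u ∈ (admissible μ w N d t k : Set (ℕ → Ω → Fin m → ℝ)),
    IsMinOn (cost μ c w N k ξ) (admissible μ w N d t k) u

/-- The delayed problem is solvable: it is solvable at every initial pair
`(k, ξ) ∈ {t, …, N-1} × ℝⁿ`. -/
def Solvable [MeasurableSpace Ω] (μ : Measure Ω) {n m : ℕ} (c : Coeffs n m)
    (w : ℕ → Ω → ℝ) (N d t : ℕ) : Prop :=
  ∀ k, t ≤ k → k < N → ∀ ξ : Fin n → ℝ, SolvableAt μ c w N d t k ξ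

end Control

/-! ### The constrained Riccati-like equations -/

/-- The last index `i` of the sums defining `W_k` and `H_k`. -/
def lastIndex (d t k : ℕ) : ℕ := if t + d ≤ k then d else k + 1 - t

/-- `W_k = R_k + ∑_i B_kᵀ P⁽ⁱ⁾_{k+1} B_k + D_kᵀ P⁽⁰⁾_{k+1} D_k`. Here `P i k` is `P⁽ⁱ⁾_k`. -/
def Wmat {n m : ℕ} (c : Coeffs n m) (d t : ℕ) (P : ℕ → ℕ → Matrix (Fin n) (Fin n) ℝ) (k : ℕ) :
    Matrix (Fin m) (Fin m) ℝ :=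
  c.R k + ∑ i ∈ Finset.range (lastIndex d t k + 1), (c.B k)ᵀ * P i (k + 1) * c.B k
    + (c.D k)ᵀ * P 0 (k + 1) * c.D k

/-- `H_k = ∑_i B_kᵀ P⁽ⁱ⁾_{k+1} A_k + D_kᵀ P⁽⁰⁾_{k+1} C_k`. -/
def Hmat {n m : ℕ} (c : Coeffs n m) (d t : ℕ) (P : ℕ → ℕ → Matrix (Fin n) (Fin n) ℝ) (k : ℕ) :
    Matrix (Fin m) (Fin n) ℝ :=
  ∑ i ∈ Finset.range (lastIndex d t k + 1), (c.B k)ᵀ * P i (k + 1) * c.A k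
    + (c.D k)ᵀ * P 0 (k + 1) * c.C k

/-- `H_kᵀ W_k† H_k`. -/
noncomputable def HWH {n m : ℕ} (c : Coeffs n m) (d t : ℕ)
    (P : ℕ → ℕ → Matrix (Fin n) (Fin n) ℝ) (k : ℕ) : Matrix (Fin n) (Fin n) ℝ :=
  (Hmat c d t P k)ᵀ * pinv (Wmat c d t P k) * Hmat c d t P k

/-- `Q_k + A_kᵀ (P⁽⁰⁾_{k+1} + P⁽¹⁾_{k+1}) A_k + C_kᵀ P⁽⁰⁾_{k+1} C_k`. -/
def lyap {n m : ℕ} (c : Coeffs n m) (P : ℕ → ℕ → Matrix (Fin n) (Fin n) ℝ) (k : ℕ) :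
    Matrix (Fin n) (Fin n) ℝ :=
  c.Q k + (c.A k)ᵀ * (P 0 (k + 1) + P 1 (k + 1)) * c.A k + (c.C k)ᵀ * P 0 (k + 1) * c.C k

/-- `P i k = P⁽ⁱ⁾_k` solves the constrained Riccati-like equations on `{t, …, N}` with delay `d`.
Every equation is imposed at the times `k ≤ N - 1` of its range. -/
structure IsConstrainedRiccatiSolution {n m : ℕ} (c : Coeffs n m) (N d t : ℕ)
    (P : ℕ → ℕ → Matrix (Fin n) (Fin n) ℝ) : Prop where
  terminal_zero : P 0 N = c.G
  terminal_succ : ∀ j, 1 ≤ j → j ≤ d → P j N = 0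
  late_zero : ∀ k, t + d ≤ k → k < N → P 0 k = lyap c P k
  late_mid : ∀ k, t + d ≤ k → k < N → ∀ i, 1 ≤ i → i + 1 ≤ d →
    P i k = (c.A k)ᵀ * P (i + 1) (k + 1) * c.A k
  late_last : ∀ k, t + d ≤ k → k < N → P d k = -HWH c d t P k
  early_zero : ∀ k, t + 2 ≤ k → k + 1 ≤ t + d → k < N → P 0 k = lyap c P k
  early_mid : ∀ k, t + 2 ≤ k → k + 1 ≤ t + d → k < N → ∀ i, 1 ≤ i → i + 1 ≤ k - t →
    P i k = (c.A k)ᵀ * P (i + 1) (k + 1) * c.A k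
  early_last : ∀ k, t + 2 ≤ k → k + 1 ≤ t + d → k < N →
    P (k - t) k = (c.A k)ᵀ * P (k + 1 - t) (k + 1) * c.A k - HWH c d t P k
  second_zero : t + 1 < N → P 0 (t + 1) = lyap c P (t + 1)
  second_last : t + 1 < N →
    P 1 (t + 1) = (c.A (t + 1))ᵀ * P 2 (t + 2) * c.A (t + 1) - HWH c d t P (t + 1)
  first_zero : t < N → P 0 t = lyap c P t - HWH c d t P t
  range_cond : ∀ k, t ≤ k → k < N →
    Wmat c d t P k * pinv (Wmat c d t P k) * Hmat c d t P k = Hmat c d t P k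
  nonneg : ∀ k, t ≤ k → k < N → (Wmat c d t P k).PosSemidef

end DelayedLQ

namespace DelayedLQ

/-! ### Generalized Schur complements -/

/-! The proof is a completion of squares for a controller whose information at time `l` lags by `lag
d t l = min d (l - t)` steps. The state `X` at time `l` is given the value `∑_i 𝔼[E_{l-i}[X]ᵀ P⁽ⁱ⁾_l
E_{l-i}[X]]`, with `i` running from `0` to the lag. A control known at the lagged time passes
through each of these conditional expectations, and the noise contributes only at `i = 0`, so after
one step every control term has the form `𝔼[Uᵀ M X]` or `𝔼[Uᵀ M U]`. The coefficients add up to `H`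
and `W`, and the Riccati-like equations are exactly what makes the rest a single square weighted by
`W` (`value_step`). Telescoping writes the cost as a constant plus such squares (`cost_eq`). If
every `W` is nonnegative, the feedback that makes all squares vanish is optimal (`solvableAt`).

It remains to solve the equations with `W ≥ 0` and the range of `H` inside that of `W`. The
recursion with pseudo-inverses can always be run; the issue is sign. The single `P⁽ⁱ⁾` need not be
nonnegative (`P⁽ᵈ⁾ = -Hᵀ W† H`), but all partial sums `S_j = P⁽⁰⁾ + ⋯ + P⁽ʲ⁾` are. Indeed `S_j` at
time `k` is `Q + Aᵀ S_{j+1} A + Cᵀ S_0 C`, with sums taken at `k + 1`, minus `Hᵀ W† H` once `j`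
reaches the lag. In that case it is the generalized Schur complement of a block form that is a sum
of nonnegative squares in `(x, u)`. Nonnegativity thus propagates backwards from `G`, and the same
block form gives the range condition (`riccati_step_nonneg`). -/

theorem isHermitian_iff_transpose_eq {n : ℕ} {M : Matrix (Fin n) (Fin n) ℝ} :
    M.IsHermitian ↔ Mᵀ = M := by
  rw [Matrix.IsHermitian, Matrix.conjTranspose_eq_transpose_of_trivial]

theorem posSemidef_iff {n : ℕ} {M : Matrix (Fin n) (Fin n) ℝ} :
    M.PosSemidef ↔ Mᵀ = M ∧ ∀ x, 0 ≤ x ⬝ᵥ M *ᵥ x := by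
  rw [posSemidef_iff_dotProduct_mulVec, isHermitian_iff_transpose_eq]
  simp

theorem pinv_transpose {n : ℕ} {W : Matrix (Fin n) (Fin n) ℝ} (hW : Wᵀ = W) :
    (pinv W)ᵀ = pinv W := by
  obtain ⟨X, hX, hXT⟩ := exists_isMoorePenrose_of_isHermitian (isHermitian_iff_transpose_eq.2 hW)
  rwa [(isMoorePenrose_pinv W).unique hX]

theorem dotProduct_mulVec_transpose {n m : ℕ} (M : Matrix (Fin n) (Fin m) ℝ)
    (x : Fin m → ℝ) (y : Fin n → ℝ) : x ⬝ᵥ Mᵀ *ᵥ y = y ⬝ᵥ M *ᵥ x := by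
  rw [Matrix.mulVec_transpose, dotProduct_comm, Matrix.dotProduct_mulVec]

/-- If the block matrix `[F, Hᵀ; H, W]` is nonnegative, the range of `H` lies in that of `W`. -/
theorem mul_pinv_mul_of_nonneg {n m : ℕ} {F : Matrix (Fin n) (Fin n) ℝ}
    {H : Matrix (Fin m) (Fin n) ℝ} {W : Matrix (Fin m) (Fin m) ℝ} (hW : Wᵀ = W)
    (h : ∀ x u, 0 ≤ x ⬝ᵥ F *ᵥ x + 2 * (u ⬝ᵥ H *ᵥ x) + u ⬝ᵥ W *ᵥ u) :
    W * pinv W * H = H := by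
  have hp := isMoorePenrose_pinv W
  have hker : ∀ v, W *ᵥ v = 0 → ∀ x, v ⬝ᵥ H *ᵥ x = 0 := by
    intro v hv x
    by_contra hne
    -- With `W v = 0` the form is affine in the multiple of `v`; this multiple makes it equal to
    -- `-1`.
    have := h x ((-(x ⬝ᵥ F *ᵥ x + 1) / (2 * (v ⬝ᵥ H *ᵥ x))) • v)
    simp only [mulVec_smul, hv, smul_zero, dotProduct_zero, smul_dotProduct, smul_eq_mul] at this
    field_simp at this
    linarith
  have hE : W * (1 - W * pinv W) = 0 := by
    have h1 : (1 - W * pinv W) * W = 0 := by rw [sub_mul, one_mul, hp.mul_mul, sub_self]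
    have h2 := congrArg transpose h1
    rwa [transpose_mul, transpose_sub, hp.symm_left, transpose_one, hW, transpose_zero] at h2
  -- By `hE` the columns of the symmetric projection `1 - W W†` lie in the kernel of `W`, hence are
  -- orthogonal to the range of `H`.
  have hEH : (1 - W * pinv W) * H = 0 := by
    have hET : (1 - W * pinv W)ᵀ = 1 - W * pinv W := by
      rw [transpose_sub, hp.symm_left, transpose_one]
    refine Matrix.ext_iff_mulVec.2 fun x => ?_
    rw [zero_mulVec]
    refine dotProduct_eq_zero _ fun y => ?_
    rw [dotProduct_comm]
    have := hker ((1 - W * pinv W) *ᵥ y) (by rw [mulVec_mulVec, hE, zero_mulVec]) x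
    rwa [dotProduct_comm, ← dotProduct_mulVec_transpose, hET, mulVec_mulVec] at this
  rw [Matrix.sub_mul, Matrix.one_mul, sub_eq_zero] at hEH
  exact hEH.symm

/-- The generalized Schur complement of a nonnegative block matrix is nonnegative. -/
theorem schur_posSemidef {n m : ℕ} {F : Matrix (Fin n) (Fin n) ℝ}
    {H : Matrix (Fin m) (Fin n) ℝ} {W : Matrix (Fin m) (Fin m) ℝ} (hF : Fᵀ = F) (hW : Wᵀ = W)
    (h : ∀ x u, 0 ≤ x ⬝ᵥ F *ᵥ x + 2 * (u ⬝ᵥ H *ᵥ x) + u ⬝ᵥ W *ᵥ u) :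
    (F - Hᵀ * pinv W * H).PosSemidef := by
  refine posSemidef_iff.2 ⟨?_, fun x => ?_⟩
  · simp [transpose_mul, hF, pinv_transpose hW, Matrix.mul_assoc]
  -- `u = -W† H x` minimizes the form over `u`; the minimum is the Schur complement evaluated at
  -- `x`.
  · have := h x (-(pinv W *ᵥ H *ᵥ x))
    have e1 : (pinv W *ᵥ H *ᵥ x) ⬝ᵥ H *ᵥ x = x ⬝ᵥ (Hᵀ * pinv W * H) *ᵥ x := by
      rw [dotProduct_comm, ← dotProduct_mulVec_transpose]
      simp only [mulVec_mulVec, Matrix.mul_assoc, pinv_transpose hW]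
      rw [dotProduct_comm, ← dotProduct_mulVec_transpose]
      simp [mulVec_mulVec]
    have e2 : (pinv W *ᵥ H *ᵥ x) ⬝ᵥ W *ᵥ (pinv W *ᵥ H *ᵥ x)
        = (pinv W *ᵥ H *ᵥ x) ⬝ᵥ H *ᵥ x := by
      rw [mulVec_mulVec, mulVec_mulVec, ← Matrix.mul_assoc, mul_pinv_mul_of_nonneg hW h]
    rw [sub_mulVec, dotProduct_sub, ← e1]
    simp only [neg_dotProduct, mulVec_neg, dotProduct_neg, neg_neg, e2] at this
    linarith

theorem quadratic_comp {n m k : ℕ} {S : Matrix (Fin k) (Fin k) ℝ} (hS : Sᵀ = S)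
    (A : Matrix (Fin k) (Fin n) ℝ) (B : Matrix (Fin k) (Fin m) ℝ) (x : Fin n → ℝ)
    (u : Fin m → ℝ) :
    (A *ᵥ x + B *ᵥ u) ⬝ᵥ S *ᵥ (A *ᵥ x + B *ᵥ u) =
      x ⬝ᵥ (Aᵀ * S * A) *ᵥ x + 2 * (u ⬝ᵥ (Bᵀ * S * A) *ᵥ x) + u ⬝ᵥ (Bᵀ * S * B) *ᵥ u := by
  have key : ∀ {p q : ℕ} (E : Matrix (Fin k) (Fin p) ℝ) (E' : Matrix (Fin k) (Fin q) ℝ) y z,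
      (E *ᵥ y) ⬝ᵥ S *ᵥ (E' *ᵥ z) = y ⬝ᵥ (Eᵀ * S * E') *ᵥ z := by
    intro p q E E' y z
    rw [dotProduct_comm, ← dotProduct_mulVec_transpose]
    simp [mulVec_mulVec, Matrix.mul_assoc]
  have hsymm : x ⬝ᵥ (Aᵀ * S * B) *ᵥ u = u ⬝ᵥ (Bᵀ * S * A) *ᵥ x := by
    rw [← dotProduct_mulVec_transpose]
    simp [transpose_mul, hS, Matrix.mul_assoc]
  simp only [mulVec_add, add_dotProduct, dotProduct_add, key]
  rw [hsymm]
  ring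

/-! ### Construction of the Riccati solution -/

section Riccati

variable {n m : ℕ} (c : Coeffs n m)

/-- The number of steps by which the controller's information lags at time `k`. -/
def lag (d t k : ℕ) : ℕ := min d (k - t)

theorem lastIndex_eq_lag {d t k : ℕ} (hk : t ≤ k) : lastIndex d t k = lag d t (k + 1) := by
  unfold lastIndex lag; split_ifs <;> omega

/-- One backward step of the Riccati-like recursion. -/
noncomputable def riccatiStep (d t k : ℕ) (P' : ℕ → Matrix (Fin n) (Fin n) ℝ) (i : ℕ) :
    Matrix (Fin n) (Fin n) ℝ :=
  (if i = 0 then c.Q k + (c.A k)ᵀ * P' 0 * c.A k + (c.C k)ᵀ * P' 0 * c.C k else 0)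
    + (c.A k)ᵀ * P' (i + 1) * c.A k
    - if i = lag d t k then HWH c d t (fun j _ => P' j) k else 0

/-- The Riccati solution, indexed by the time to go. -/
noncomputable def riccatiAux (N d t : ℕ) : ℕ → ℕ → Matrix (Fin n) (Fin n) ℝ
  | 0 => fun i => if i = 0 then c.G else 0
  | s + 1 => riccatiStep c d t (N - (s + 1)) (riccatiAux N d t s)

/-- The solution of the constrained Riccati-like equations. -/
noncomputable def riccati (N d t i k : ℕ) : Matrix (Fin n) (Fin n) ℝ :=
  riccatiAux c N d t (N - k) i

theorem riccati_terminal (N d t i : ℕ) : riccati c N d t i N = if i = 0 then c.G else 0 := by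
  simp [riccati, riccatiAux]

/-- One formula covers every time regime: the quadratic term is subtracted at the index equal to the
lag, which is `0` at `k = t`, then `k - t`, and finally `d`. -/
theorem riccati_eq {N k : ℕ} (d t i : ℕ) (hk : k < N) :
    riccati c N d t i k =
      (if i = 0 then c.Q k + (c.A k)ᵀ * riccati c N d t 0 (k + 1) * c.A k
        + (c.C k)ᵀ * riccati c N d t 0 (k + 1) * c.C k else 0)
      + (c.A k)ᵀ * riccati c N d t (i + 1) (k + 1) * c.A k
      - if i = lag d t k then HWH c d t (riccati c N d t) k else 0 := by
  obtain ⟨s, rfl⟩ : ∃ s, N = k + 1 + s := ⟨N - (k + 1), by omega⟩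
  have h1 : k + 1 + s - k = s + 1 := by omega
  have h2 : k + 1 + s - (k + 1) = s := by omega
  have h3 : k + 1 + s - (s + 1) = k := by omega
  simp only [riccati, h1, h2, riccatiAux, h3, riccatiStep, HWH, Hmat, Wmat]

/-- The lag grows by at most one per step, so an index `i` above the lag at `k` has `i + 1` above
the lag at `k + 1`; no source term ever reaches it. -/
theorem riccati_eq_zero {N d t : ℕ} {k i : ℕ} (hk : t ≤ k) (hkN : k ≤ N) (hi : lag d t k < i) :
    riccati c N d t i k = 0 := by
  induction hkN using Nat.decreasingInduction generalizing i with
  | self =>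
    rw [riccati_terminal, if_neg (by unfold lag at hi; omega)]
  | of_succ k hkN ih =>
    rw [riccati_eq c d t i hkN, ih (i := i + 1) (by omega) (by unfold lag at *; omega),
      if_neg (by omega), if_neg (by omega)]
    simp

/-- Sums of `riccati` over all indices up to the lag may be extended. -/
theorem sum_riccati_eq {N d t : ℕ} {k : ℕ} (hk : t ≤ k) (hkN : k ≤ N) {j : ℕ}
    (hj : lag d t k ≤ j) {M : Type*} [AddCommMonoid M]
    (f : ℕ → Matrix (Fin n) (Fin n) ℝ → M) (hf : ∀ i, f i 0 = 0) :
    ∑ i ∈ Finset.range (j + 1), f i (riccati c N d t i k)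
      = ∑ i ∈ Finset.range (lag d t k + 1), f i (riccati c N d t i k) := by
  symm
  refine Finset.sum_subset (fun i => by simp only [Finset.mem_range]; omega) fun i _ hi => ?_
  rw [riccati_eq_zero c hk hkN (by simpa [Nat.succ_le_iff] using hi), hf]

/-! ### Partial sums and their nonnegativity -/

variable {N d t : ℕ}

/-- The partial sums `∑_{i ≤ j} P⁽ⁱ⁾_k`. -/
noncomputable def riccatiSum (N d t j k : ℕ) : Matrix (Fin n) (Fin n) ℝ :=
  ∑ i ∈ Finset.range (j + 1), riccati c N d t i k

theorem Wmat_riccati {k j : ℕ} (hk : t ≤ k) (hkN : k < N)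
    (hj : lag d t (k + 1) ≤ j) :
    Wmat c d t (riccati c N d t) k = c.R k
      + (c.B k)ᵀ * riccatiSum c N d t j (k + 1) * c.B k
      + (c.D k)ᵀ * riccatiSum c N d t 0 (k + 1) * c.D k := by
  rw [Wmat, lastIndex_eq_lag hk, riccatiSum,
    Matrix.mul_sum, Matrix.sum_mul, sum_riccati_eq c (by omega) hkN hj
      (fun _ M => (c.B k)ᵀ * M * c.B k) (by simp)]
  simp [riccatiSum]

theorem Hmat_riccati {k j : ℕ} (hk : t ≤ k) (hkN : k < N)
    (hj : lag d t (k + 1) ≤ j) :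
    Hmat c d t (riccati c N d t) k =
      (c.B k)ᵀ * riccatiSum c N d t j (k + 1) * c.A k
      + (c.D k)ᵀ * riccatiSum c N d t 0 (k + 1) * c.C k := by
  rw [Hmat, lastIndex_eq_lag hk, riccatiSum,
    Matrix.mul_sum, Matrix.sum_mul, sum_riccati_eq c (by omega) hkN hj
      (fun _ M => (c.B k)ᵀ * M * c.A k) (by simp)]
  simp [riccatiSum]

/-- Summation turns the index shift `i ↦ i + 1` into `j ↦ j + 1`: the shifted terms miss only
`P⁽⁰⁾_{k+1}`, which the equation for `i = 0` supplies. -/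
theorem riccatiSum_eq {k : ℕ} (hkN : k < N) (j : ℕ) :
    riccatiSum c N d t j k = c.Q k + (c.A k)ᵀ * riccatiSum c N d t (j + 1) (k + 1) * c.A k
      + (c.C k)ᵀ * riccatiSum c N d t 0 (k + 1) * c.C k
      - if lag d t k ≤ j then HWH c d t (riccati c N d t) k else 0 := by
  have e1 : riccatiSum c N d t (j + 1) (k + 1) = riccati c N d t 0 (k + 1)
      + ∑ i ∈ Finset.range (j + 1), riccati c N d t (i + 1) (k + 1) := by
    rw [riccatiSum, Finset.sum_range_succ', add_comm]
  have e2 : riccatiSum c N d t j k = ∑ i ∈ Finset.range (j + 1), _ :=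
    Finset.sum_congr rfl fun i _ => riccati_eq c d t i hkN
  rw [e2, Finset.sum_sub_distrib, Finset.sum_add_distrib, Finset.sum_ite_eq', Finset.sum_ite_eq',
    ← Matrix.sum_mul, ← Matrix.mul_sum, e1]
  simp only [Finset.mem_range, Nat.lt_succ_iff, zero_le, if_true]
  simp only [riccatiSum, Matrix.mul_add, Matrix.add_mul, zero_add, Finset.sum_range_one]
  abel

/-- The Riccati-like equations preserve nonnegativity, with the accompanying constraints. -/
theorem riccati_step_nonneg {k : ℕ} (hk : t ≤ k) (hkN : k < N)
    (hQ : (c.Q k).PosSemidef) (hR : (c.R k).PosSemidef)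
    (hS : ∀ j, (riccatiSum c N d t j (k + 1)).PosSemidef) :
    (Wmat c d t (riccati c N d t) k).PosSemidef ∧
    Wmat c d t (riccati c N d t) k * pinv (Wmat c d t (riccati c N d t) k)
      * Hmat c d t (riccati c N d t) k = Hmat c d t (riccati c N d t) k ∧
    ∀ j, (riccatiSum c N d t j k).PosSemidef := by
  have hcong : ∀ {p : ℕ} {S : Matrix (Fin n) (Fin n) ℝ} (E : Matrix (Fin n) (Fin p) ℝ),
      S.PosSemidef → (Eᵀ * S * E).PosSemidef := by
    intro p S E hS
    have := hS.conjTranspose_mul_mul_same E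
    rwa [conjTranspose_eq_transpose_of_trivial] at this
  have hF : ∀ j, (c.Q k + (c.A k)ᵀ * riccatiSum c N d t j (k + 1) * c.A k
      + (c.C k)ᵀ * riccatiSum c N d t 0 (k + 1) * c.C k).PosSemidef := fun j =>
    (hQ.add (hcong _ (hS j))).add (hcong _ (hS 0))
  have hW : (Wmat c d t (riccati c N d t) k).PosSemidef := by
    rw [Wmat_riccati c hk hkN le_rfl]
    exact (hR.add (hcong _ (hS _))).add (hcong _ (hS 0))
  have hblock : ∀ j, lag d t (k + 1) ≤ j → ∀ x u,
      0 ≤ x ⬝ᵥ (c.Q k + (c.A k)ᵀ * riccatiSum c N d t j (k + 1) * c.A k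
          + (c.C k)ᵀ * riccatiSum c N d t 0 (k + 1) * c.C k) *ᵥ x
        + 2 * (u ⬝ᵥ Hmat c d t (riccati c N d t) k *ᵥ x)
        + u ⬝ᵥ Wmat c d t (riccati c N d t) k *ᵥ u := by
    intro j hj x u
    have h1 := quadratic_comp (posSemidef_iff.1 (hS j)).1 (c.A k) (c.B k) x u
    have h2 := quadratic_comp (posSemidef_iff.1 (hS 0)).1 (c.C k) (c.D k) x u
    have h3 := (posSemidef_iff.1 (hS j)).2 (c.A k *ᵥ x + c.B k *ᵥ u)
    have h4 := (posSemidef_iff.1 (hS 0)).2 (c.C k *ᵥ x + c.D k *ᵥ u)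
    have h5 := (posSemidef_iff.1 hQ).2 x
    have h6 := (posSemidef_iff.1 hR).2 u
    rw [Wmat_riccati c hk hkN hj, Hmat_riccati c hk hkN hj]
    simp only [add_mulVec, dotProduct_add]
    linarith
  have hWT := (posSemidef_iff.1 hW).1
  refine ⟨hW, mul_pinv_mul_of_nonneg hWT (hblock _ le_rfl), fun j => ?_⟩
  rw [riccatiSum_eq c hkN]
  split_ifs with hj
  -- The block form is used at `j + 1`, which dominates the lag at `k + 1` because `j` dominates the
  -- lag at `k`.
  · exact schur_posSemidef (posSemidef_iff.1 (hF _)).1 hWT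
      (hblock _ (by unfold lag at *; omega))
  · rw [sub_zero]; exact hF _

theorem riccatiSum_posSemidef 
    (hQ : ∀ k, t ≤ k → k < N → (c.Q k).PosSemidef)
    (hR : ∀ k, t ≤ k → k < N → (c.R k).PosSemidef) (hG : c.G.PosSemidef)
    {k : ℕ} (hk : t ≤ k) (hkN : k ≤ N) (j : ℕ) : (riccatiSum c N d t j k).PosSemidef := by
  induction hkN using Nat.decreasingInduction generalizing j with
  | self => simpa [riccatiSum, riccati_terminal] using hG
  | of_succ k hkN ih =>
    exact (riccati_step_nonneg c hk hkN (hQ k hk hkN) (hR k hk hkN)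
      (ih (by omega))).2.2 j

theorem riccati_constraints 
    (hQ : ∀ k, t ≤ k → k < N → (c.Q k).PosSemidef)
    (hR : ∀ k, t ≤ k → k < N → (c.R k).PosSemidef) (hG : c.G.PosSemidef)
    {k : ℕ} (hk : t ≤ k) (hkN : k < N) :
    (Wmat c d t (riccati c N d t) k).PosSemidef ∧
    Wmat c d t (riccati c N d t) k * pinv (Wmat c d t (riccati c N d t) k)
      * Hmat c d t (riccati c N d t) k = Hmat c d t (riccati c N d t) k := by
  obtain ⟨h1, h2, _⟩ := riccati_step_nonneg c hk hkN (hQ k hk hkN) (hR k hk hkN)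
    (fun j => riccatiSum_posSemidef c hQ hR hG (by omega) (by omega) j)
  exact ⟨h1, h2⟩

/-- Each `P⁽ⁱ⁾` is a difference of consecutive partial sums, which are symmetric. -/
theorem riccati_transpose 
    (hQ : ∀ k, t ≤ k → k < N → (c.Q k).PosSemidef)
    (hR : ∀ k, t ≤ k → k < N → (c.R k).PosSemidef) (hG : c.G.PosSemidef)
    {k : ℕ} (hk : t ≤ k) (hkN : k ≤ N) (i : ℕ) :
    (riccati c N d t i k)ᵀ = riccati c N d t i k := by
  have hS := fun j =>
    (posSemidef_iff.1 (riccatiSum_posSemidef (d := d) c hQ hR hG hk hkN j)).1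
  cases i with
  | zero => simpa [riccatiSum] using hS 0
  | succ i =>
    have e : riccati c N d t (i + 1) k = riccatiSum c N d t (i + 1) k - riccatiSum c N d t i k := by
      rw [riccatiSum, Finset.sum_range_succ, riccatiSum, add_sub_cancel_left]
    rw [e, transpose_sub, hS, hS]

/-! ### Verification of the constrained equations -/

theorem isConstrainedRiccatiSolution_riccati (hd : 2 ≤ d)
    (hQ : ∀ k, t ≤ k → k < N → (c.Q k).PosSemidef)
    (hR : ∀ k, t ≤ k → k < N → (c.R k).PosSemidef) (hG : c.G.PosSemidef) :
    IsConstrainedRiccatiSolution c N d t (riccati c N d t) := by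
  have zero : ∀ k, t + 1 ≤ k → k < N →
      riccati c N d t 0 k = lyap c (riccati c N d t) k := by
    intro k hk hkN
    rw [riccati_eq c d t 0 hkN, if_pos rfl, if_neg (by unfold lag; omega), lyap]
    simp only [Matrix.mul_add, Matrix.add_mul, zero_add]
    abel
  have mid : ∀ k i, k < N → 1 ≤ i → i < lag d t k →
      riccati c N d t i k = (c.A k)ᵀ * riccati c N d t (i + 1) (k + 1) * c.A k := by
    intro k i hkN hi hl
    rw [riccati_eq c d t i hkN, if_neg (by omega), if_neg (by omega), zero_add, sub_zero]
  have last : ∀ k i, t + 1 ≤ k → k < N → i = lag d t k →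
      riccati c N d t i k = (c.A k)ᵀ * riccati c N d t (i + 1) (k + 1) * c.A k
        - HWH c d t (riccati c N d t) k := by
    intro k i hk hkN hl
    rw [riccati_eq c d t i hkN, if_neg (by unfold lag at hl; omega), if_pos hl, zero_add]
  refine
    { terminal_zero := by rw [riccati_terminal, if_pos rfl]
      terminal_succ := fun j hj _ => by rw [riccati_terminal, if_neg (by omega)]
      late_zero := fun k hk hkN => zero k (by omega) hkN
      late_mid := fun k hk hkN i hi hid => mid k i hkN hi (by unfold lag; omega)
      late_last := fun k hk hkN => ?_
      early_zero := fun k hk _ hkN => zero k (by omega) hkN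
      early_mid := fun k hk hkd hkN i hi hik => mid k i hkN hi (by unfold lag; omega)
      early_last := fun k hk hkd hkN => ?_
      second_zero := fun hkN => zero _ le_rfl hkN
      second_last := fun hkN => last _ 1 le_rfl hkN (by unfold lag; omega)
      first_zero := fun hkN => ?_
      range_cond := fun k hk hkN => (riccati_constraints c hQ hR hG hk hkN).2
      nonneg := fun k hk hkN => (riccati_constraints c hQ hR hG hk hkN).1 }
  -- The shifted term drops out: `P⁽ᵈ⁺¹⁾_{k+1}` lies beyond the lag.
  · rw [last k d (by omega) hkN (by unfold lag; omega),
      riccati_eq_zero c (by omega) hkN (by unfold lag; omega)]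
    simp
  · rw [last k (k - t) (by omega) hkN (by unfold lag; omega),
      show k - t + 1 = k + 1 - t by omega]
  · rw [riccati_eq c d t 0 hkN, if_pos rfl, if_pos (by unfold lag; omega), lyap]
    simp only [Matrix.mul_add, Matrix.add_mul, zero_add]
    abel

end Riccati

/-! ### Second moments of square-integrable random vectors -/

section Moments

variable {Ω : Type*} {mΩ : MeasurableSpace Ω} {μ : Measure Ω} {n m k : ℕ}

theorem memLp_mulVec {X : Ω → Fin n → ℝ} (hX : MemLp X 2 μ) (A : Matrix (Fin m) (Fin n) ℝ) :
    MemLp (fun ω => A *ᵥ X ω) 2 μ :=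
  (LinearMap.toContinuousLinearMap A.mulVecLin).comp_memLp' hX

theorem measurable_mulVec {𝓕 : MeasurableSpace Ω} {X : Ω → Fin n → ℝ} (hX : Measurable[𝓕] X)
    (A : Matrix (Fin m) (Fin n) ℝ) : Measurable[𝓕] (fun ω => A *ᵥ X ω) :=
  (LinearMap.toContinuousLinearMap A.mulVecLin).continuous.measurable.comp hX

theorem integrable_mul_apply {X : Ω → Fin n → ℝ} {Y : Ω → Fin m → ℝ} (hX : MemLp X 2 μ)
    (hY : MemLp Y 2 μ) (i : Fin n) (j : Fin m) : Integrable (fun ω => X ω i * Y ω j) μ :=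
  (hX.eval i).integrable_mul (hY.eval j)

theorem integrable_dotProduct_mulVec {X : Ω → Fin n → ℝ} {Y : Ω → Fin m → ℝ} (hX : MemLp X 2 μ)
    (hY : MemLp Y 2 μ) (M : Matrix (Fin n) (Fin m) ℝ) :
    Integrable (fun ω => X ω ⬝ᵥ M *ᵥ Y ω) μ :=
  integrable_finsetSum _ fun i _ =>
    (hX.eval i).integrable_mul ((memLp_mulVec hY M).eval i)

theorem memLp_of_integrable_dotProduct {X : Ω → Fin n → ℝ} (hX : Measurable X)
    (h : Integrable (fun ω => X ω ⬝ᵥ X ω) μ) : MemLp X 2 μ := by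
  refine MemLp.of_eval fun i => ?_
  have hi : Measurable fun ω => X ω i := (measurable_pi_apply i).comp hX
  rw [memLp_two_iff_integrable_sq hi.aestronglyMeasurable]
  refine h.mono' (hi.pow_const 2).aestronglyMeasurable (ae_of_all _ fun ω => ?_)
  rw [Real.norm_of_nonneg (sq_nonneg _), sq]
  exact Finset.single_le_sum (f := fun j => X ω j * X ω j) (fun j _ => mul_self_nonneg _)
    (Finset.mem_univ i)

/-- The bilinear second moment `M ↦ 𝔼[Xᵀ M Y]`, as a linear functional of the matrix `M`. -/
noncomputable def moment (μ : Measure Ω) (X : Ω → Fin n → ℝ) (Y : Ω → Fin m → ℝ) :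
    Matrix (Fin n) (Fin m) ℝ →ₗ[ℝ] ℝ where
  -- Entrywise moments make linearity in `M` independent of integrability.
  toFun M := ∑ i, ∑ j, M i j * ∫ ω, X ω i * Y ω j ∂μ
  map_add' M M' := by simp only [Matrix.add_apply, add_mul, Finset.sum_add_distrib]
  map_smul' a M := by
    simp only [Matrix.smul_apply, smul_eq_mul, mul_assoc, Finset.mul_sum, RingHom.id_apply]

theorem moment_apply {X : Ω → Fin n → ℝ} {Y : Ω → Fin m → ℝ} (hX : MemLp X 2 μ)
    (hY : MemLp Y 2 μ) (M : Matrix (Fin n) (Fin m) ℝ) :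
    moment μ X Y M = ∫ ω, X ω ⬝ᵥ M *ᵥ Y ω ∂μ := by
  have h : ∀ ω, X ω ⬝ᵥ M *ᵥ Y ω = ∑ i, ∑ j, M i j * (X ω i * Y ω j) := fun ω => by
    simp only [dotProduct, mulVec, Finset.mul_sum]
    exact Finset.sum_congr rfl fun i _ => Finset.sum_congr rfl fun j _ => by ring
  have hint : ∀ i j, Integrable (fun ω => M i j * (X ω i * Y ω j)) μ := fun i j =>
    (integrable_mul_apply hX hY i j).const_mul _
  simp only [h]
  change ∑ i, ∑ j, M i j * ∫ ω, X ω i * Y ω j ∂μ = _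
  rw [integral_finsetSum _ fun i _ => integrable_finsetSum _ fun j _ => hint i j]
  refine Finset.sum_congr rfl fun i _ => ?_
  rw [integral_finsetSum _ fun j _ => hint i j]
  exact Finset.sum_congr rfl fun j _ => (integral_const_mul _ _).symm

theorem moment_congr {X X' : Ω → Fin n → ℝ} {Y Y' : Ω → Fin m → ℝ}
    (h : ∀ i j, ∫ ω, X ω i * Y ω j ∂μ = ∫ ω, X' ω i * Y' ω j ∂μ) :
    moment μ X Y = moment μ X' Y' :=
  LinearMap.ext fun M => show ∑ i, ∑ j, M i j * _ = ∑ i, ∑ j, M i j * _ by simp only [h]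

theorem moment_congr_ae {X X' : Ω → Fin n → ℝ} {Y Y' : Ω → Fin m → ℝ} (hX : X =ᵐ[μ] X')
    (hY : Y =ᵐ[μ] Y') : moment μ X Y = moment μ X' Y' := by
  refine moment_congr fun i j => ?_
  refine integral_congr_ae ?_
  filter_upwards [hX, hY] with ω h1 h2
  rw [h1, h2]

theorem moment_self_nonneg {X : Ω → Fin n → ℝ} (hX : MemLp X 2 μ) {M : Matrix (Fin n) (Fin n) ℝ}
    (hM : M.PosSemidef) : 0 ≤ moment μ X X M := by
  rw [moment_apply hX hX]
  exact integral_nonneg fun ω => (posSemidef_iff.1 hM).2 _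

/-- Expansion of a quadratic second moment of `A X + B U`. -/
theorem moment_self_comp {X : Ω → Fin n → ℝ} {U : Ω → Fin m → ℝ} (hX : MemLp X 2 μ)
    (hU : MemLp U 2 μ) {S : Matrix (Fin k) (Fin k) ℝ} (hS : Sᵀ = S)
    (A : Matrix (Fin k) (Fin n) ℝ) (B : Matrix (Fin k) (Fin m) ℝ) :
    moment μ (fun ω => A *ᵥ X ω + B *ᵥ U ω) (fun ω => A *ᵥ X ω + B *ᵥ U ω) S
      = moment μ X X (Aᵀ * S * A) + 2 * moment μ U X (Bᵀ * S * A)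
        + moment μ U U (Bᵀ * S * B) := by
  have h : MemLp (fun ω => A *ᵥ X ω + B *ᵥ U ω) 2 μ :=
    (memLp_mulVec hX A).add (memLp_mulVec hU B)
  have h1 := integrable_dotProduct_mulVec hX hX (Aᵀ * S * A)
  have h2 := (integrable_dotProduct_mulVec hU hX (Bᵀ * S * A)).const_mul 2
  have h3 := integrable_dotProduct_mulVec hU hU (Bᵀ * S * B)
  have h12 : Integrable (fun ω => X ω ⬝ᵥ (Aᵀ * S * A) *ᵥ X ω
      + 2 * (U ω ⬝ᵥ (Bᵀ * S * A) *ᵥ X ω)) μ := h1.add h2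
  rw [moment_apply h h, moment_apply hX hX, moment_apply hU hX, moment_apply hU hU,
    ← integral_const_mul, ← integral_add h1 h2, ← integral_add h12 h3]
  exact integral_congr_ae (ae_of_all _ fun ω => quadratic_comp hS A B (X ω) (U ω))

theorem condExp_apply {X : Ω → Fin n → ℝ} (hX : Integrable X μ) (𝓕 : MeasurableSpace Ω)
    (i : Fin n) : (fun ω => (μ[X | 𝓕]) ω i) =ᵐ[μ] μ[fun ω => X ω i | 𝓕] :=
  (ContinuousLinearMap.proj (R := ℝ) (φ := fun _ : Fin n => ℝ) i).comp_condExp_comm hX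

theorem condExp_mulVec {X : Ω → Fin n → ℝ} (hX : Integrable X μ) (𝓕 : MeasurableSpace Ω)
    (A : Matrix (Fin m) (Fin n) ℝ) :
    μ[fun ω => A *ᵥ X ω | 𝓕] =ᵐ[μ] fun ω => A *ᵥ (μ[X | 𝓕]) ω :=
  ((LinearMap.toContinuousLinearMap A.mulVecLin).comp_condExp_comm hX).symm

variable [IsFiniteMeasure μ]

/-- Against `𝓕`-measurable vectors, `X` may be replaced by `𝔼[X | 𝓕]`. -/
theorem moment_condExp {𝓕 : MeasurableSpace Ω} (h𝓕 : 𝓕 ≤ mΩ) {U : Ω → Fin m → ℝ}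
    {X : Ω → Fin n → ℝ} (hU : MemLp U 2 μ) (hUm : Measurable[𝓕] U) (hX : MemLp X 2 μ) :
    moment μ U (μ[X | 𝓕]) = moment μ U X := by
  refine moment_congr fun i j => ?_
  have hXj := condExp_apply (hX.integrable one_le_two) 𝓕 j
  have hpull : μ[(fun ω => U ω i) * (fun ω => X ω j) | 𝓕] =ᵐ[μ]
      (fun ω => U ω i) * μ[fun ω => X ω j | 𝓕] :=
    condExp_mul_of_stronglyMeasurable_left
      (((measurable_pi_apply i).comp hUm).stronglyMeasurable)
      (integrable_mul_apply hU hX i j) ((hX.eval j).integrable one_le_two)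
  calc ∫ ω, U ω i * (μ[X | 𝓕]) ω j ∂μ
      = ∫ ω, (μ[(fun ω => U ω i) * (fun ω => X ω j) | 𝓕]) ω ∂μ := by
        refine integral_congr_ae ?_
        filter_upwards [hXj, hpull] with ω h1 h2
        rw [h2, h1]; rfl
    _ = ∫ ω, U ω i * X ω j ∂μ := integral_condExp h𝓕

/-! ### Multiplication by a noise of zero mean and unit conditional variance -/

section Noise

variable {𝓕 : MeasurableSpace Ω} {v : Ω → ℝ}

/-- The measure with density `g` agrees with `μ` on `𝓕`. Working with nonnegative integrals avoids
assuming that the product is integrable, which is what has to be proved for `v² Z²`. -/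
theorem lintegral_mul_of_condExp_eq_one (h𝓕 : 𝓕 ≤ mΩ) {g : Ω → ℝ} (hg : Integrable g μ)
    (hg0 : 0 ≤ g) (hg1 : μ[g | 𝓕] =ᵐ[μ] fun _ => 1) {f : Ω → ENNReal} (hf : Measurable[𝓕] f) :
    ∫⁻ ω, f ω * ENNReal.ofReal (g ω) ∂μ = ∫⁻ ω, f ω ∂μ := by
  have hgm : AEMeasurable (fun ω => ENNReal.ofReal (g ω)) μ := hg.aemeasurable.ennreal_ofReal
  have htrim : (μ.withDensity fun ω => ENNReal.ofReal (g ω)).trim h𝓕 = μ.trim h𝓕 := by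
    refine @Measure.ext _ 𝓕 _ _ fun s hs => ?_
    rw [trim_measurableSet_eq h𝓕 hs, trim_measurableSet_eq h𝓕 hs,
      withDensity_apply _ (h𝓕 s hs), ← ofReal_integral_eq_lintegral_ofReal hg.integrableOn
        (ae_of_all _ hg0), ← setIntegral_condExp h𝓕 hg hs,
      setIntegral_congr_ae (h𝓕 s hs) (hg1.mono fun ω h _ => h)]
    simp
  calc ∫⁻ ω, f ω * ENNReal.ofReal (g ω) ∂μ
      = ∫⁻ ω, f ω ∂(μ.withDensity fun ω => ENNReal.ofReal (g ω)) := by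
        rw [lintegral_withDensity_eq_lintegral_mul₀ hgm (hf.mono h𝓕 le_rfl).aemeasurable]
        simp only [Pi.mul_apply, mul_comm]
    _ = ∫⁻ ω, f ω ∂μ := by rw [← lintegral_trim h𝓕 hf, htrim, lintegral_trim h𝓕 hf]

/-- A product of two square-integrable functions is in general only integrable; here the unit
conditional variance gives `𝔼[v² Z_i²] = 𝔼[Z_i²]`. -/
theorem memLp_noise_smul (h𝓕 : 𝓕 ≤ mΩ) (hv : MemLp v 2 μ)
    (hv1 : μ[fun ω => v ω ^ 2 | 𝓕] =ᵐ[μ] fun _ => 1) {Z : Ω → Fin n → ℝ}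
    (hZ : MemLp Z 2 μ) (hZm : Measurable[𝓕] Z) : MemLp (fun ω => v ω • Z ω) 2 μ := by
  refine MemLp.of_eval fun i => ?_
  have hZi : Measurable[𝓕] fun ω => Z ω i := (measurable_pi_apply i).comp hZm
  have hmeas : AEStronglyMeasurable[mΩ] (fun ω => (v ω • Z ω) i) μ :=
    hv.1.mul (hZi.mono h𝓕 le_rfl).aestronglyMeasurable
  rw [memLp_two_iff_integrable_sq hmeas]
  refine ⟨hmeas.pow 2, ?_⟩
  have key := lintegral_mul_of_condExp_eq_one h𝓕 hv.integrable_sq (fun ω => sq_nonneg (v ω)) hv1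
    (f := fun ω => ENNReal.ofReal (Z ω i ^ 2)) (hZi.pow_const 2).ennreal_ofReal
  rw [hasFiniteIntegral_iff_ofReal (ae_of_all _ fun ω => sq_nonneg _)]
  calc ∫⁻ ω, ENNReal.ofReal ((v ω • Z ω) i ^ 2) ∂μ
      = ∫⁻ ω, ENNReal.ofReal (Z ω i ^ 2) * ENNReal.ofReal (v ω ^ 2) ∂μ := by
        refine lintegral_congr fun ω => ?_
        rw [← ENNReal.ofReal_mul (sq_nonneg _)]
        congr 1; simp only [Pi.smul_apply, smul_eq_mul]; ring
    _ = ∫⁻ ω, ENNReal.ofReal (Z ω i ^ 2) ∂μ := key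
    _ < ⊤ := (hZ.eval i).integrable_sq.lintegral_lt_top

theorem condExp_noise_smul (h𝓕 : 𝓕 ≤ mΩ) (hv : MemLp v 2 μ) (hv0 : μ[v | 𝓕] =ᵐ[μ] fun _ => 0)
    (hv1 : μ[fun ω => v ω ^ 2 | 𝓕] =ᵐ[μ] fun _ => 1) {Z : Ω → Fin n → ℝ}
    (hZ : MemLp Z 2 μ) (hZm : Measurable[𝓕] Z) : μ[fun ω => v ω • Z ω | 𝓕] =ᵐ[μ] 0 := by
  have h : μ[fun ω => v ω • Z ω | 𝓕] =ᵐ[μ] fun ω => (μ[v | 𝓕]) ω • Z ω :=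
    condExp_smul_of_aestronglyMeasurable_right (hv.integrable one_le_two)
      ((memLp_noise_smul h𝓕 hv hv1 hZ hZm).integrable one_le_two)
      hZm.stronglyMeasurable.aestronglyMeasurable
  filter_upwards [h, hv0] with ω h1 h2
  rw [h1, h2, zero_smul]; rfl

theorem moment_noise_smul_eq_zero (h𝓕 : 𝓕 ≤ mΩ) (hv : MemLp v 2 μ) (hv0 : μ[v | 𝓕] =ᵐ[μ] fun _ => 0)
    (hv1 : μ[fun ω => v ω ^ 2 | 𝓕] =ᵐ[μ] fun _ => 1) {Y : Ω → Fin m → ℝ} {Z : Ω → Fin n → ℝ}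
    (hY : MemLp Y 2 μ) (hYm : Measurable[𝓕] Y) (hZ : MemLp Z 2 μ) (hZm : Measurable[𝓕] Z) :
    moment μ Y (fun ω => v ω • Z ω) = 0 := by
  rw [← moment_condExp h𝓕 hY hYm (memLp_noise_smul h𝓕 hv hv1 hZ hZm),
    moment_congr_ae (ae_eq_refl Y) (condExp_noise_smul h𝓕 hv hv0 hv1 hZ hZm)]
  exact LinearMap.ext fun M => by simp [moment]

theorem moment_noise_smul (h𝓕 : 𝓕 ≤ mΩ) (hv : MemLp v 2 μ)
    (hv1 : μ[fun ω => v ω ^ 2 | 𝓕] =ᵐ[μ] fun _ => 1) {Z : Ω → Fin n → ℝ}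
    (hZ : MemLp Z 2 μ) (hZm : Measurable[𝓕] Z) :
    moment μ (fun ω => v ω • Z ω) (fun ω => v ω • Z ω) = moment μ Z Z := by
  refine moment_congr fun i j => ?_
  have hvZ := memLp_noise_smul h𝓕 hv hv1 hZ hZm
  have hpull : μ[(fun ω => Z ω i * Z ω j) * (fun ω => v ω ^ 2) | 𝓕] =ᵐ[μ]
      (fun ω => Z ω i * Z ω j) * μ[fun ω => v ω ^ 2 | 𝓕] := by
    refine condExp_mul_of_stronglyMeasurable_left
      (((measurable_pi_apply i).comp hZm).mul
        ((measurable_pi_apply j).comp hZm)).stronglyMeasurable ?_ hv.integrable_sq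
    refine (integrable_mul_apply hvZ hvZ i j).congr (ae_of_all _ fun ω => ?_)
    simp only [Pi.smul_apply, smul_eq_mul, Pi.mul_apply]; ring
  calc ∫ ω, (v ω • Z ω) i * (v ω • Z ω) j ∂μ
      = ∫ ω, ((fun ω => Z ω i * Z ω j) * (fun ω => v ω ^ 2)) ω ∂μ := by
        refine integral_congr_ae (ae_of_all _ fun ω => ?_)
        simp only [Pi.smul_apply, smul_eq_mul, Pi.mul_apply]; ring
    _ = ∫ ω, (μ[(fun ω => Z ω i * Z ω j) * (fun ω => v ω ^ 2) | 𝓕]) ω ∂μ :=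
        (integral_condExp h𝓕).symm
    _ = ∫ ω, Z ω i * Z ω j ∂μ := by
        refine integral_congr_ae ?_
        filter_upwards [hpull, hv1] with ω h1 h2
        simp [h1, h2]

/-- The noise is orthogonal to the past and isometric on it. -/
theorem moment_add_noise_smul (h𝓕 : 𝓕 ≤ mΩ) (hv : MemLp v 2 μ)
    (hv0 : μ[v | 𝓕] =ᵐ[μ] fun _ => 0)
    (hv1 : μ[fun ω => v ω ^ 2 | 𝓕] =ᵐ[μ] fun _ => 1) {Y Z : Ω → Fin n → ℝ}
    (hY : MemLp Y 2 μ) (hYm : Measurable[𝓕] Y) (hZ : MemLp Z 2 μ) (hZm : Measurable[𝓕] Z)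
    {S : Matrix (Fin n) (Fin n) ℝ} (hS : Sᵀ = S) :
    moment μ (fun ω => Y ω + v ω • Z ω) (fun ω => Y ω + v ω • Z ω) S
      = moment μ Y Y S + moment μ Z Z S := by
  have h := moment_self_comp (memLp_noise_smul h𝓕 hv hv1 hZ hZm) hY hS 1 1
  simp only [one_mulVec, transpose_one, Matrix.one_mul, Matrix.mul_one] at h
  rw [moment_noise_smul_eq_zero h𝓕 hv hv0 hv1 hY hYm hZ hZm, moment_noise_smul h𝓕 hv hv1 hZ hZm] at h
  simp only [add_comm (Y _), h, LinearMap.zero_apply]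
  ring

end Noise

end Moments

/-! ### The information filtration and the state process -/

section StateSystem

variable {Ω : Type*} {n m : ℕ} {c : Coeffs n m} {N d t k : ℕ} {w : ℕ → Ω → ℝ}
  {ξ : Fin n → ℝ} {u : ℕ → Ω → Fin m → ℝ}

theorem info_mono (w : ℕ → Ω → ℝ) {k l : ℕ} (h : k ≤ l) : info w k ≤ info w l :=
  iSup₂_le fun i hi => le_iSup₂_of_le i (hi.trans_le h) le_rfl

theorem measurable_info_succ (w : ℕ → Ω → ℝ) (l : ℕ) : Measurable[info w (l + 1)] (w l) :=
  Measurable.of_comap_le (le_iSup₂_of_le l l.lt_succ_self le_rfl)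

/-- Before `t + d` the lag is `l - t`, so `l` minus the lag stays at `t`; afterwards the lag is `d`.
-/
theorem delayedInfo_eq (w : ℕ → Ω → ℝ) {l : ℕ} (hl : t ≤ l) :
    delayedInfo w d t l = info w (l - lag d t l) := by
  unfold delayedInfo lag
  split_ifs <;> congr 1 <;> omega

theorem state_self : state c w k ξ u k = fun _ => ξ := by
  cases k with
  | zero => rfl
  | succ k => funext ω; simp [state]

theorem state_succ {l : ℕ} (hl : k ≤ l) :
    state c w k ξ u (l + 1) = fun ω =>
      (c.A l *ᵥ state c w k ξ u l ω + c.B l *ᵥ u l ω)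
        + w l ω • (c.C l *ᵥ state c w k ξ u l ω + c.D l *ᵥ u l ω) := by
  funext ω; simp [state, hl]

/-- The state in closed loop with the feedback `F`. -/
def closedLoop (c : Coeffs n m) (w : ℕ → Ω → ℝ) (k : ℕ) (ξ : Fin n → ℝ)
    (F : ℕ → (Ω → Fin n → ℝ) → Ω → Fin m → ℝ) : ℕ → Ω → Fin n → ℝ
  | 0 => fun _ => ξ
  | l + 1 => fun ω =>
      if k ≤ l then
        (c.A l *ᵥ closedLoop c w k ξ F l ω + c.B l *ᵥ F l (closedLoop c w k ξ F l) ω)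
          + w l ω • (c.C l *ᵥ closedLoop c w k ξ F l ω + c.D l *ᵥ F l (closedLoop c w k ξ F l) ω)
      else ξ

/-- The feedback acts on the state as a random vector, not pointwise, so that it may involve
conditional expectations. -/
theorem exists_feedback_control (c : Coeffs n m) (w : ℕ → Ω → ℝ) (k : ℕ) (ξ : Fin n → ℝ)
    (F : ℕ → (Ω → Fin n → ℝ) → Ω → Fin m → ℝ) :
    ∃ u : ℕ → Ω → Fin m → ℝ, ∀ l, u l = F l (state c w k ξ u l) := by
  refine ⟨fun l => F l (closedLoop c w k ξ F l), fun l => ?_⟩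
  suffices h : closedLoop c w k ξ F l =
      state c w k ξ (fun l => F l (closedLoop c w k ξ F l)) l from congrArg (F l) h
  induction l with
  | zero => rfl
  | succ l ih => funext ω; simp only [state, closedLoop, ← ih]

variable [mΩ : MeasurableSpace Ω] {μ : Measure Ω}

theorem IsNoise.info_le (hw : IsNoise μ N w) {l : ℕ} (hl : l ≤ N) : info w l ≤ mΩ :=
  iSup₂_le fun i hi => (hw.measurable i (hi.trans_le hl)).comap_le

theorem state_step [IsFiniteMeasure μ] (hw : IsNoise μ N w) {l : ℕ} (hlN : l < N)
    {X : Ω → Fin n → ℝ} {U : Ω → Fin m → ℝ} (hX : Measurable[info w l] X) (hX2 : MemLp X 2 μ)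
    (hU : Measurable[info w l] U) (hU2 : MemLp U 2 μ) :
    Measurable[info w (l + 1)] (fun ω => (c.A l *ᵥ X ω + c.B l *ᵥ U ω)
      + w l ω • (c.C l *ᵥ X ω + c.D l *ᵥ U ω)) ∧
    MemLp (fun ω => (c.A l *ᵥ X ω + c.B l *ᵥ U ω)
      + w l ω • (c.C l *ᵥ X ω + c.D l *ᵥ U ω)) 2 μ := by
  have hY : ∀ (E : Matrix (Fin n) (Fin n) ℝ) (E' : Matrix (Fin n) (Fin m) ℝ),
      Measurable[info w l] (fun ω => E *ᵥ X ω + E' *ᵥ U ω) := fun E E' =>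
    (measurable_mulVec hX E).add (measurable_mulVec hU E')
  have hY2 : ∀ (E : Matrix (Fin n) (Fin n) ℝ) (E' : Matrix (Fin n) (Fin m) ℝ),
      MemLp (fun ω => E *ᵥ X ω + E' *ᵥ U ω) 2 μ := fun E E' =>
    (memLp_mulVec hX2 E).add (memLp_mulVec hU2 E')
  have hle := info_mono w l.le_succ
  exact ⟨((hY _ _).mono hle le_rfl).add
      ((measurable_info_succ w l).smul ((hY _ _).mono hle le_rfl)),
    (hY2 _ _).add (memLp_noise_smul (hw.info_le hlN.le) (hw.memLp l hlN)
      (hw.condExp_sq_eq_one l hlN) (hY2 _ _) (hY _ _))⟩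

/-- Only controls before `l` are constrained, so this applies while a feedback control is still
being shown admissible by induction. -/
theorem state_props [IsFiniteMeasure μ] (hw : IsNoise μ N w) (htk : t ≤ k) {l : ℕ} (hkl : k ≤ l)
    (hlN : l ≤ N) (hu : ∀ j, k ≤ j → j < l → Measurable[delayedInfo w d t j] (u j) ∧
      MemLp (u j) 2 μ) :
    Measurable[info w l] (state c w k ξ u l) ∧ MemLp (state c w k ξ u l) 2 μ := by
  induction l, hkl using Nat.le_induction with
  | base => rw [state_self]; exact ⟨measurable_const, memLp_const ξ⟩
  | succ l hkl ih =>
    obtain ⟨h1, h2⟩ := ih (by omega) fun j hj hjl => hu j hj (by omega)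
    obtain ⟨h3, h4⟩ := hu l hkl (by omega)
    rw [delayedInfo_eq w (htk.trans hkl)] at h3
    rw [state_succ hkl]
    exact state_step hw (by omega) h1 h2 (h3.mono (info_mono w (by omega)) le_rfl) h4

theorem memLp_of_mem_admissible (hw : IsNoise μ N w) (htk : t ≤ k)
    (hu : u ∈ (admissible μ w N d t k : Set (ℕ → Ω → Fin m → ℝ))) {l : ℕ} (hkl : k ≤ l)
    (hlN : l < N) : Measurable[delayedInfo w d t l] (u l) ∧ MemLp (u l) 2 μ := by
  obtain ⟨h1, h2⟩ := hu l hkl hlN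
  refine ⟨h1, memLp_of_integrable_dotProduct (h1.mono ?_ le_rfl) h2⟩
  rw [delayedInfo_eq w (htk.trans hkl)]
  exact hw.info_le (by omega)

/-! ### Completion of squares -/

/-- The value `∑_i 𝔼[E_{l-i}[X]ᵀ P⁽ⁱ⁾_l E_{l-i}[X]]` of the state `X` at time `l`. -/
noncomputable def value (μ : Measure Ω) (c : Coeffs n m) (w : ℕ → Ω → ℝ) (N d t l : ℕ)
    (X : Ω → Fin n → ℝ) : ℝ :=
  ∑ i ∈ Finset.range (lag d t l + 1),
    moment μ (μ[X | info w (l - i)]) (μ[X | info w (l - i)]) (riccati c N d t i l)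

/-- The gain of the optimal feedback. -/
noncomputable def gain (c : Coeffs n m) (N d t l : ℕ) : Matrix (Fin m) (Fin n) ℝ :=
  pinv (Wmat c d t (riccati c N d t) l) * Hmat c d t (riccati c N d t) l

/-- The deviation of the control `U` from the optimal feedback at the state `X`. -/
noncomputable def deviation (μ : Measure Ω) (c : Coeffs n m) (w : ℕ → Ω → ℝ) (N d t l : ℕ)
    (X : Ω → Fin n → ℝ) (U : Ω → Fin m → ℝ) : Ω → Fin m → ℝ := fun ω =>
  gain c N d t l *ᵥ (μ[X | info w (l - lag d t l)]) ω + U ω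

theorem condExp_state_step [IsFiniteMeasure μ] (hw : IsNoise μ N w) {l s : ℕ} (hlN : l < N)
    (hs : s ≤ l) {X : Ω → Fin n → ℝ} {U : Ω → Fin m → ℝ} (hX : Measurable[info w l] X)
    (hX2 : MemLp X 2 μ) (hU : Measurable[info w s] U) (hU2 : MemLp U 2 μ) :
    μ[fun ω => (c.A l *ᵥ X ω + c.B l *ᵥ U ω)
      + w l ω • (c.C l *ᵥ X ω + c.D l *ᵥ U ω) | info w s] =ᵐ[μ]
    fun ω => c.A l *ᵥ (μ[X | info w s]) ω + c.B l *ᵥ U ω := by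
  have hle := info_mono w hs
  have hAX := memLp_mulVec hX2 (c.A l)
  have hBU := memLp_mulVec hU2 (c.B l)
  have hZ : MemLp (fun ω => c.C l *ᵥ X ω + c.D l *ᵥ U ω) 2 μ :=
    (memLp_mulVec hX2 _).add (memLp_mulVec hU2 _)
  have hZm : Measurable[info w l] (fun ω => c.C l *ᵥ X ω + c.D l *ᵥ U ω) :=
    (measurable_mulVec hX _).add (measurable_mulVec (hU.mono hle le_rfl) _)
  have hvZ := memLp_noise_smul (hw.info_le hlN.le) (hw.memLp l hlN)
    (hw.condExp_sq_eq_one l hlN) hZ hZm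
  -- Tower property: the noise term already vanishes conditionally on the larger `info w l`.
  have e0 : μ[fun ω => w l ω • (c.C l *ᵥ X ω + c.D l *ᵥ U ω) | info w s] =ᵐ[μ] 0 := by
    refine (condExp_condExp_of_le hle (hw.info_le hlN.le)).symm.trans ?_
    refine (condExp_congr_ae (condExp_noise_smul (hw.info_le hlN.le) (hw.memLp l hlN)
      (hw.condExp_eq_zero l hlN) (hw.condExp_sq_eq_one l hlN) hZ hZm)).trans ?_
    rw [condExp_zero]
  have e1 := condExp_add ((hAX.add hBU).integrable one_le_two) (hvZ.integrable one_le_two)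
    (info w s)
  have e2 := condExp_add (hAX.integrable one_le_two) (hBU.integrable one_le_two) (info w s)
  have e3 := condExp_mulVec (hX2.integrable one_le_two) (info w s) (c.A l)
  have e4 : μ[fun ω => c.B l *ᵥ U ω | info w s] = fun ω => c.B l *ᵥ U ω :=
    condExp_of_stronglyMeasurable (hw.info_le (by omega))
      (measurable_mulVec hU _).stronglyMeasurable (hBU.integrable one_le_two)
  refine e1.trans ?_
  filter_upwards [e0, e2, e3] with ω h0 h2 h3
  rw [Pi.add_apply, h0, h2, Pi.add_apply, h3, e4]
  simp

theorem value_step [IsFiniteMeasure μ] (hw : IsNoise μ N w)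
    (hQ : ∀ k, t ≤ k → k < N → (c.Q k).PosSemidef)
    (hR : ∀ k, t ≤ k → k < N → (c.R k).PosSemidef) (hG : c.G.PosSemidef)
    {l : ℕ} (htl : t ≤ l) (hlN : l < N) {X : Ω → Fin n → ℝ} {U : Ω → Fin m → ℝ}
    (hX : Measurable[info w l] X) (hX2 : MemLp X 2 μ)
    (hU : Measurable[info w (l - lag d t l)] U) (hU2 : MemLp U 2 μ) :
    moment μ X X (c.Q l) + moment μ U U (c.R l)
      + value μ c w N d t (l + 1) (fun ω => (c.A l *ᵥ X ω + c.B l *ᵥ U ω)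
          + w l ω • (c.C l *ᵥ X ω + c.D l *ᵥ U ω))
    = value μ c w N d t l X
      + moment μ (deviation μ c w N d t l X U) (deviation μ c w N d t l X U)
          (Wmat c d t (riccati c N d t) l) := by
  set X' : Ω → Fin n → ℝ := fun ω => (c.A l *ᵥ X ω + c.B l *ᵥ U ω)
          + w l ω • (c.C l *ᵥ X ω + c.D l *ᵥ U ω) with hX'
  set P := riccati c N d t with hP
  have hUl := hU.mono (info_mono w (Nat.sub_le l (lag d t l))) le_rfl
  have hsymm : ∀ i, (P i (l + 1))ᵀ = P i (l + 1) := fun i =>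
    riccati_transpose c hQ hR hG (by omega) (by omega) i
  obtain ⟨hW, hWH⟩ := riccati_constraints (d := d) c hQ hR hG htl hlN
  have hWT := (posSemidef_iff.1 hW).1
  have hle : ∀ i, info w (l - i) ≤ mΩ := fun i => hw.info_le (by omega)
  have hx2 : ∀ i, MemLp (μ[X | info w (l - i)]) 2 μ := fun i => hX2.condExp one_le_two
  have hself : μ[X | info w (l - 0)] = X :=
    condExp_of_stronglyMeasurable (hle 0) hX.stronglyMeasurable (hX2.integrable one_le_two)
  -- For `i` up to the lag, `U` is known at time `l - i`, so conditioning `X` does not change its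
  -- moment against `U`.
  have hcross : ∀ i, i ≤ lag d t l → moment μ U (μ[X | info w (l - i)]) = moment μ U X :=
    fun i hi => moment_condExp (hle i) hU2 (hU.mono (info_mono w (by omega)) le_rfl) hX2
  have hX'2 := state_step (c := c) hw hlN hX hX2 hUl hU2
  have hzero : moment μ (μ[X' | info w (l + 1 - 0)]) (μ[X' | info w (l + 1 - 0)]) (P 0 (l + 1))
      = (moment μ X X ((c.A l)ᵀ * P 0 (l + 1) * c.A l)
        + 2 * moment μ U X ((c.B l)ᵀ * P 0 (l + 1) * c.A l)
        + moment μ U U ((c.B l)ᵀ * P 0 (l + 1) * c.B l))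
      + (moment μ X X ((c.C l)ᵀ * P 0 (l + 1) * c.C l)
        + 2 * moment μ U X ((c.D l)ᵀ * P 0 (l + 1) * c.C l)
        + moment μ U U ((c.D l)ᵀ * P 0 (l + 1) * c.D l)) := by
    have e : μ[X' | info w (l + 1 - 0)] = X' :=
      condExp_of_stronglyMeasurable (hw.info_le (by omega)) hX'2.1.stronglyMeasurable
        (hX'2.2.integrable one_le_two)
    rw [e, ← moment_self_comp hX2 hU2 (hsymm 0), ← moment_self_comp hX2 hU2 (hsymm 0)]
    exact moment_add_noise_smul (hw.info_le hlN.le) (hw.memLp l hlN) (hw.condExp_eq_zero l hlN)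
      (hw.condExp_sq_eq_one l hlN) ((memLp_mulVec hX2 _).add (memLp_mulVec hU2 _))
      ((measurable_mulVec hX _).add (measurable_mulVec hUl _))
      ((memLp_mulVec hX2 _).add (memLp_mulVec hU2 _))
      ((measurable_mulVec hX _).add (measurable_mulVec hUl _)) (hsymm 0)
  have hsucc : ∀ i ∈ Finset.range (lag d t l + 1),
      moment μ (μ[X' | info w (l + 1 - (i + 1))]) (μ[X' | info w (l + 1 - (i + 1))])
        (P (i + 1) (l + 1))
      = moment μ (μ[X | info w (l - i)]) (μ[X | info w (l - i)])
          ((c.A l)ᵀ * P (i + 1) (l + 1) * c.A l)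
        + 2 * moment μ U X ((c.B l)ᵀ * P (i + 1) (l + 1) * c.A l)
        + moment μ U U ((c.B l)ᵀ * P (i + 1) (l + 1) * c.B l) := by
    intro i hi
    have hi' : i ≤ lag d t l := Nat.lt_succ_iff.1 (Finset.mem_range.1 hi)
    have e := condExp_state_step (c := c) (s := l - i) hw hlN (Nat.sub_le l i) hX hX2
      (hU.mono (info_mono w (by omega)) le_rfl) hU2
    rw [Nat.add_sub_add_right, moment_congr_ae e e, moment_self_comp (hx2 i) hU2 (hsymm _),
      hcross i hi']
  -- The lag at `l + 1` may equal that at `l` or exceed it by one; padding with zero terms treats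
  -- both cases and matches index `i + 1` with `i`.
  have hV' : value μ c w N d t (l + 1) X' =
      ∑ i ∈ Finset.range (lag d t l + 1 + 1),
        moment μ (μ[X' | info w (l + 1 - i)]) (μ[X' | info w (l + 1 - i)]) (P i (l + 1)) :=
    (sum_riccati_eq c (by omega) hlN (by unfold lag; omega)
      (fun i M => moment μ (μ[X' | info w (l + 1 - i)]) (μ[X' | info w (l + 1 - i)]) M)
      fun i => map_zero _).symm
  have hV : value μ c w N d t l X =
      moment μ X X (c.Q l + (c.A l)ᵀ * P 0 (l + 1) * c.A l + (c.C l)ᵀ * P 0 (l + 1) * c.C l)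
      + ∑ i ∈ Finset.range (lag d t l + 1), moment μ (μ[X | info w (l - i)])
          (μ[X | info w (l - i)]) ((c.A l)ᵀ * P (i + 1) (l + 1) * c.A l)
      - moment μ (μ[X | info w (l - lag d t l)]) (μ[X | info w (l - lag d t l)])
          (HWH c d t P l) := by
    unfold value
    simp only [riccati_eq c d t _ hlN, map_add, map_sub, apply_ite (moment μ _ _), map_zero,
      Finset.sum_add_distrib, Finset.sum_sub_distrib, Finset.sum_ite_eq', Finset.mem_range,
      Nat.succ_pos, Nat.lt_succ_self, if_true, hself, ← hP]
  have hdev : moment μ (deviation μ c w N d t l X U) (deviation μ c w N d t l X U)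
        (Wmat c d t P l) =
      moment μ (μ[X | info w (l - lag d t l)]) (μ[X | info w (l - lag d t l)]) (HWH c d t P l)
      + 2 * moment μ U X (Hmat c d t P l) + moment μ U U (Wmat c d t P l) := by
    have h := moment_self_comp (hx2 (lag d t l)) hU2 hWT (gain c N d t l) 1
    -- The range condition is what makes the cross term of the square equal to `H`.
    have hWK : Wmat c d t P l * gain c N d t l = Hmat c d t P l := by
      rw [gain, ← Matrix.mul_assoc, hWH]
    have hKWK : (gain c N d t l)ᵀ * Wmat c d t P l * gain c N d t l = HWH c d t P l := by
      rw [Matrix.mul_assoc, hWK, gain, transpose_mul, pinv_transpose hWT, HWH]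
    simp only [one_mulVec, transpose_one, Matrix.one_mul, Matrix.mul_one] at h
    rw [hKWK, hWK, hcross _ le_rfl] at h
    exact h
  have hlag : lag d t (l + 1) ≤ lag d t l + 1 := by unfold lag; omega
  rw [hV', Finset.sum_range_succ', hzero, Finset.sum_congr rfl hsucc, hV, hdev,
    Wmat_riccati c htl hlN hlag, Hmat_riccati c htl hlN hlag]
  simp only [riccatiSum, Finset.sum_range_succ' _ (lag d t l + 1), zero_add, Finset.sum_range_one,
    Matrix.mul_add, Matrix.add_mul, Matrix.mul_sum, Matrix.sum_mul, map_add, map_sum,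
    Finset.sum_add_distrib, ← Finset.mul_sum, ← hP]
  ring

theorem value_terminal [IsFiniteMeasure μ] (hw : IsNoise μ N w) {X : Ω → Fin n → ℝ}
    (hX : Measurable[info w N] X) (hX2 : MemLp X 2 μ) :
    value μ c w N d t N X = moment μ X X c.G := by
  have hself : μ[X | info w (N - 0)] = X :=
    condExp_of_stronglyMeasurable (hw.info_le le_rfl) hX.stronglyMeasurable
      (hX2.integrable one_le_two)
  unfold value
  simp only [riccati_terminal, apply_ite (moment μ _ _), map_zero, Finset.sum_ite_eq',
    Finset.mem_range, Nat.succ_pos, if_true, hself]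

/-- The cost is a constant plus a sum of weighted squared deviations from the feedback. -/
theorem cost_eq [IsFiniteMeasure μ] (hw : IsNoise μ N w)
    (hQ : ∀ k, t ≤ k → k < N → (c.Q k).PosSemidef)
    (hR : ∀ k, t ≤ k → k < N → (c.R k).PosSemidef) (hG : c.G.PosSemidef)
    (htk : t ≤ k) (hkN : k < N)
    (hu : ∀ l, k ≤ l → l < N → Measurable[delayedInfo w d t l] (u l) ∧ MemLp (u l) 2 μ) :
    cost μ c w N k ξ u = value μ c w N d t k (fun _ => ξ)
      + ∑ l ∈ Finset.Ico k N,
        moment μ (deviation μ c w N d t l (state c w k ξ u l) (u l))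
          (deviation μ c w N d t l (state c w k ξ u l) (u l))
          (Wmat c d t (riccati c N d t) l) := by
  have hX : ∀ l, k ≤ l → l ≤ N →
      Measurable[info w l] (state c w k ξ u l) ∧ MemLp (state c w k ξ u l) 2 μ :=
    fun l hkl hlN => state_props hw htk hkl hlN fun j hkj hjl => hu j hkj (hjl.trans_le hlN)
  have key : ∀ j, k ≤ j → j ≤ N →
      ∑ l ∈ Finset.Ico k j, ∫ ω, (state c w k ξ u l ω ⬝ᵥ c.Q l *ᵥ state c w k ξ u l ω
          + u l ω ⬝ᵥ c.R l *ᵥ u l ω) ∂μ + value μ c w N d t j (state c w k ξ u j)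
      = value μ c w N d t k (fun _ => ξ) + ∑ l ∈ Finset.Ico k j,
        moment μ (deviation μ c w N d t l (state c w k ξ u l) (u l))
          (deviation μ c w N d t l (state c w k ξ u l) (u l))
          (Wmat c d t (riccati c N d t) l) := by
    intro j hkj
    induction j, hkj using Nat.le_induction with
    | base => intro _; simp [state_self]
    | succ l hkl ih =>
      intro hlN
      obtain ⟨h1, h2⟩ := hX l hkl (by omega)
      obtain ⟨h3, h4⟩ := hu l hkl hlN
      rw [delayedInfo_eq w (htk.trans hkl)] at h3
      have hstep := value_step hw hQ hR hG (htk.trans hkl) hlN h1 h2 h3 h4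
      rw [← state_succ hkl, moment_apply h2 h2, moment_apply h4 h4, ← integral_add
        (integrable_dotProduct_mulVec h2 h2 _) (integrable_dotProduct_mulVec h4 h4 _)] at hstep
      rw [Finset.sum_Ico_succ_top hkl, Finset.sum_Ico_succ_top hkl]
      linarith [ih (by omega)]
  obtain ⟨h1, h2⟩ := hX N hkN.le le_rfl
  rw [← key N hkN.le le_rfl, value_terminal hw h1 h2, moment_apply h2 h2, cost]

/-! ### Existence of an optimal control -/

theorem solvableAt [IsFiniteMeasure μ] (hw : IsNoise μ N w)
    (hQ : ∀ k, t ≤ k → k < N → (c.Q k).PosSemidef)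
    (hR : ∀ k, t ≤ k → k < N → (c.R k).PosSemidef) (hG : c.G.PosSemidef)
    (htk : t ≤ k) (hkN : k < N) (ξ : Fin n → ℝ) : SolvableAt μ c w N d t k ξ := by
  obtain ⟨u, hu⟩ := exists_feedback_control c w k ξ fun l X ω =>
    -(gain c N d t l *ᵥ (μ[X | info w (l - lag d t l)]) ω)
  have hprops : ∀ l, k ≤ l → l < N →
      Measurable[delayedInfo w d t l] (u l) ∧ MemLp (u l) 2 μ := by
    -- Strong induction: square integrability of the feedback at `l` needs that of the state, hence
    -- of all earlier controls.
    intro l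
    induction l using Nat.strong_induction_on with
    | _ l ih =>
      intro hkl hlN
      obtain ⟨_, h2⟩ := state_props (c := c) (ξ := ξ) (u := u) (d := d) hw htk hkl hlN.le
        fun j hkj hjl => ih j hjl hkj (by omega)
      rw [delayedInfo_eq w (htk.trans hkl), hu l]
      exact ⟨(measurable_mulVec stronglyMeasurable_condExp.measurable _).neg,
        (memLp_mulVec (h2.condExp one_le_two) _).neg⟩
  refine ⟨u, fun l hkl hlN => ⟨(hprops l hkl hlN).1, ?_⟩, fun u' hu' => ?_⟩
  · have h := (hprops l hkl hlN).2
    simpa only [one_mulVec] using integrable_dotProduct_mulVec h h 1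
  · have hprops' := fun l hkl hlN => memLp_of_mem_admissible hw htk hu' (l := l) hkl hlN
    change cost μ c w N k ξ u ≤ cost μ c w N k ξ u'
    rw [cost_eq hw hQ hR hG htk hkN hprops, cost_eq hw hQ hR hG htk hkN hprops']
    refine add_le_add le_rfl (Finset.sum_le_sum fun l hl => ?_)
    obtain ⟨hkl, hlN⟩ := Finset.mem_Ico.1 hl
    have h0 : deviation μ c w N d t l (state c w k ξ u l) (u l) = fun _ => 0 := by
      funext ω
      rw [deviation, congrFun (hu l) ω, add_neg_cancel]
    have hX' := (state_props (c := c) (ξ := ξ) hw htk hkl hlN.le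
      fun j hkj hjl => hprops' j hkj (hjl.trans hlN)).2
    have h1 : MemLp (deviation μ c w N d t l (state c w k ξ u' l) (u' l)) 2 μ :=
      (memLp_mulVec (hX'.condExp one_le_two) _).add (hprops' l hkl hlN).2
    refine le_trans (le_of_eq ?_) (moment_self_nonneg h1
      (riccati_constraints c hQ hR hG (htk.trans hkl) hlN).1)
    rw [h0]
    simp [moment]

end StateSystem

end DelayedLQ

theorem mainTheorem11 {Ω : Type*} [MeasurableSpace Ω] (μ : Measure Ω) [IsProbabilityMeasure μ]
    {n m : ℕ} (c : DelayedLQ.Coeffs n m) (N d t : ℕ) (hd : 2 ≤ d) (ht : t < N)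
    (w : ℕ → Ω → ℝ) (hw : DelayedLQ.IsNoise μ N w)
    (hQ : ∀ k, t ≤ k → k < N → (c.Q k).PosSemidef)
    (hR : ∀ k, t ≤ k → k < N → (c.R k).PosSemidef)
    (hG : c.G.PosSemidef) :
    DelayedLQ.Solvable μ c w N d t ∧
      ∃ P : ℕ → ℕ → Matrix (Fin n) (Fin n) ℝ,
        DelayedLQ.IsConstrainedRiccatiSolution c N d t P :=
  ⟨fun _ htk hkN ξ => DelayedLQ.solvableAt hw hQ hR hG htk hkN ξ,
    _, DelayedLQ.isConstrainedRiccatiSolution_riccati c hd hQ hR hG⟩
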